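/- Let $\Sigma$ be a finite totally ordered alphabet of size $\sigma$ and let $T, P \in \Sigma^*$. For a string $U$ let $\mathsf{slink}(U)$ be $U$ without its first symbol. The linear-size suffix trie $\mathsf{LST}(T)$ has as nodes the type-1 nodes, i.e. the substrings $U$ of $T$ that are suffixes of $T$ (in particular the root $\varepsilon$) or for which $Ua$ and $Ub$ occur in $T$ for two distinct symbols $a,b$, and the type-2 nodes, i.e. the other substrings $U$ of $T$ for which $\mathsf{slink}(U)$ is a type-1 node. The parent of a node $V\neq\varepsilon$ is its longest proper prefix $U$ that is a node; the edge $(U,V)$ stores only the single symbol that follows $U$ in $V$, and $V$ stores a flag $\mathsf{+}$ that says whether $|V|-|U|\ge 2$. The fast link of an edge $(U,V)$ is $(\mathsf{slink}^h(U),\mathsf{slink}^h(V))$ for the least $h \le |U|$ such that $\mathsf{slink}^h(U)$ is not the parent of $\mathsf{slink}^h(V)$, if such an $h$ exists. There is an algorithm which, given $\mathsf{LST}(T)$ with its fast links (but not $T$) and the pattern $P$, finds the longest prefix $P'$ of $P$ that occurs in $T$ (it outputs $|P'|$) in $O\big((|P'|+1)(\log\sigma+1)\big)$ time; that is, in $O(|P'|\log\sigma)$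 time if $|P'|\ge 1$ and $\sigma\ge 2$. The algorithm is one program, and the constant one number, for all $\Sigma$, $T$ and $P$. The model is a unit-cost random access machine, on which symbols can only be copied and compared, whose words hold numbers up to a constant multiple of the memory size of the input; the outgoing edges of each node are given in a table sorted by edge label. -/

import Mathlib

/-! Linear-size suffix tries (LSTs) with fast links, the random access machine on which
running times are measured, and the way an LST is given to such a machine.
Strings over an alphabet `α` are lists; a node is identified with its path label;
`U <+: V`, `U <:+ V`, `U <:+: V` say that `U` is a prefix, suffix, substring of `V`. -/

namespace LST

variable {α : Type*}

/-- The suffix link: delete the first symbol. -/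
def slink (U : List α) : List α := U.tail

/-- `U` is a type-1 node of the LST of `T`, that is, an explicit node of the suffix tree of `T`
in which every suffix of `T` (in particular the empty one, the root) is explicit:
`U` is a suffix of `T`, or it is followed by two distinct symbols in `T`. -/
def IsType1 (T U : List α) : Prop :=
  U <:+ T ∨ ∃ a b : α, a ≠ b ∧ (U ++ [a]) <:+: T ∧ (U ++ [b]) <:+: T

/-- `U` is a type-2 node: a substring of `T` that is not a type-1 node and
whose suffix link points to a type-1 node. -/
def IsType2 (T U : List α) : Prop :=
  U <:+: T ∧ ¬ IsType1 T U ∧ IsType1 T (slink U)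

/-- `U` is a node of the LST of `T`. -/
def IsNode (T U : List α) : Prop := IsType1 T U ∨ IsType2 T U

/-- `U` is the parent of `V` in the LST of `T`, that is, `(U, V)` is an edge. -/
def IsParent (T U V : List α) : Prop :=
  IsNode T U ∧ IsNode T V ∧ U <+: V ∧ U ≠ V ∧
    ∀ W : List α, IsNode T W → U <+: W → W <+: V → W = U ∨ W = V

/-- `(U, V)` is an edge with label `c`, that is, `V = child(U, c)`. The edge label is
the first symbol on the path from `U` to `V` in the suffix trie. -/
def IsChild (T U : List α) (c : α) (V : List α) : Prop :=
  IsParent T U V ∧ (U ++ [c]) <+: V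

/-- `V` is a `+`-node: the path from its parent to it in the suffix trie has length at least 2. -/
def IsPlus (T V : List α) : Prop :=
  ∃ U : List α, IsParent T U V ∧ U.length + 2 ≤ V.length

/-- `fastLink(U, V) = (slink^h(U), slink^h(V))`, i.e. `h` is the least number of suffix links that
take `U` and `V` to nodes of which the first is not the parent of the second.
(`h ≤ |U|`, as the root has no suffix link within the tree.) -/
def IsFastLinkHeight (T U V : List α) (h : ℕ) : Prop :=
  h ≤ U.length ∧ ¬ IsParent T (slink^[h] U) (slink^[h] V) ∧
    ∀ i < h, IsParent T (slink^[i] U) (slink^[i] V)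

/-- `P'` is the longest prefix of `P` that occurs in `T`. -/
def IsLongestPrefix (T P P' : List α) : Prop :=
  P' <+: P ∧ P' <:+: T ∧ ∀ Q : List α, Q <+: P → Q <:+: T → Q.length ≤ P'.length

end LST

namespace RAM

/-- A machine word holds a natural number or a symbol of the alphabet.
Programs can copy symbols and compare them, nothing else. -/
inductive Word (α : Type*) where
  | num (n : ℕ) : Word α
  | sym (c : α) : Word α
  deriving DecidableEq

/-- Instructions; the arguments `d a b s` are names of registers, `l` is a position in the program,
`n` is a constant. Instructions do not mention the alphabet. -/
inductive Instr where
  /-- `R[d] := n` -/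
  | const (d n : ℕ)
  /-- `R[d] := R[s]` -/
  | move (d s : ℕ)
  /-- `R[d] := R[a] + R[b]` -/
  | add (d a b : ℕ)
  /-- `R[d] := max (R[a] - R[b]) 0` -/
  | sub (d a b : ℕ)
  /-- `R[d] := ⌊R[a] / 2⌋` -/
  | half (d a : ℕ)
  /-- `R[d] := M[R[a]]` -/
  | load (d a : ℕ)
  /-- `M[R[a]] := R[s]` -/
  | store (a s : ℕ)
  /-- go to `l` -/
  | jump (l : ℕ)
  /-- if `R[a] = R[b]` then go to `l` -/
  | jumpEq (a b l : ℕ)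
  /-- if `R[a] < R[b]` then go to `l` -/
  | jumpLt (a b l : ℕ)
  /-- stop -/
  | halt

/-- A program is a finite list of instructions. -/
abbrev Program := List Instr

/-- A configuration: program counter, registers, memory. -/
structure Config (α : Type*) where
  pc : ℕ
  reg : ℕ → Word α
  mem : ℕ → Word α

variable {α : Type*}

/-- Write a word to register `d` and go to the next instruction. -/
def Config.set (x : Config α) (d : ℕ) (w : Word α) : Config α :=
  { x with pc := x.pc + 1, reg := Function.update x.reg d w }

/-- Go to `l` if `b` holds, otherwise to the next instruction. -/
def Config.branch (x : Config α) (b : Bool) (l : ℕ) : Config α :=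
  { x with pc := if b then l else x.pc + 1 }

variable [LinearOrder α]

/-- The effect of one instruction on a machine whose words hold numbers up to `W`.
The value `none` is a fault: an overflow, arithmetic on symbols, a symbol used as an address,
a number compared with a symbol for order. -/
def Instr.exec (W : ℕ) (x : Config α) : Instr → Option (Config α)
  | .const d n => if n ≤ W then some (x.set d (.num n)) else none
  | .move d s => some (x.set d (x.reg s))
  | .add d a b =>
    match x.reg a, x.reg b with
    | .num m, .num n => if m + n ≤ W then some (x.set d (.num (m + n))) else none
    | _, _ => none
  | .sub d a b =>
    match x.reg a, x.reg b with
    | .num m, .num n => some (x.set d (.num (m - n)))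
    | _, _ => none
  | .half d a =>
    match x.reg a with
    | .num m => some (x.set d (.num (m / 2)))
    | _ => none
  | .load d a =>
    match x.reg a with
    | .num m => some (x.set d (x.mem m))
    | _ => none
  | .store a s =>
    match x.reg a with
    | .num m => some { x with pc := x.pc + 1, mem := Function.update x.mem m (x.reg s) }
    | _ => none
  | .jump l => some (x.branch true l)
  | .jumpEq a b l => some (x.branch (decide (x.reg a = x.reg b)) l)
  | .jumpLt a b l =>
    match x.reg a, x.reg b with
    | .num m, .num n => some (x.branch (decide (m < n)) l)
    | .sym c, .sym e => some (x.branch (decide (c < e)) l)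
    | _, _ => none
  | .halt => none

/-- One step of a program. -/
def step (W : ℕ) (prog : Program) (x : Config α) : Option (Config α) :=
  (prog[x.pc]?).bind fun i => i.exec W x

/-- `t` steps of a program. -/
def run (W : ℕ) (prog : Program) : ℕ → Config α → Option (Config α)
  | 0, x => some x
  | t + 1, x => (step W prog x).bind (run W prog t)

/-- Started in `x`, the program executes at most `B` unit-cost instructions without a fault,
arrives at a `halt` instruction, and then register `0` holds the number `k`. -/
def HaltsWithin (W : ℕ) (prog : Program) (x : Config α) (B k : ℕ) : Prop :=
  ∃ t ≤ B, ∃ y : Config α, run W prog t x = some y ∧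
    prog[y.pc]? = some Instr.halt ∧ y.reg 0 = Word.num k

end RAM

namespace LST

open RAM

variable {α : Type*} [LinearOrder α]

/-- Where the parts of an LST are placed in memory: the address of the record of each node, the
address of the table of its outgoing edges, and the entries of that table. -/
structure Layout (α : Type*) where
  addr : List α → ℕ
  table : List α → ℕ
  kids : List α → List (α × List α)

/-- The cells below `free` of the memory `mem` hold the LST of `T` with its fast links, placed
according to `L`.
* Different nodes have different addresses.
* The record of a node `U` has 4 cells: the `+`-flag, the suffix link (if `U` is not the root),
  the number of children, and the address of the table of the outgoing edges.
* That table lists the outgoing edges `(U, V)` by increasing label. An entry has 4 cells: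
  the label, the address of `V`, and, if `(U, V)` has a fast link `(U', V')`,
  the addresses of `U'` and `V'`. -/
structure Stores (T : List α) (mem : ℕ → Word α) (free : ℕ) (L : Layout α) : Prop where
  addr_inj : ∀ U V : List α, IsNode T U → IsNode T V → L.addr U = L.addr V → U = V
  addr_lt : ∀ U : List α, IsNode T U → L.addr U + 4 ≤ free
  plus_true : ∀ U : List α, IsNode T U → IsPlus T U → mem (L.addr U) = .num 1
  plus_false : ∀ U : List α, IsNode T U → ¬ IsPlus T U → mem (L.addr U) = .num 0
  suffix_link : ∀ U : List α, IsNode T U → U ≠ [] →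
    mem (L.addr U + 1) = .num (L.addr (slink U))
  kids_sorted : ∀ U : List α, IsNode T U → (L.kids U).Pairwise fun x y => x.1 < y.1
  mem_kids : ∀ U : List α, IsNode T U →
    ∀ (c : α) (V : List α), (c, V) ∈ L.kids U ↔ IsChild T U c V
  kids_length : ∀ U : List α, IsNode T U → mem (L.addr U + 2) = .num (L.kids U).length
  table_addr : ∀ U : List α, IsNode T U → mem (L.addr U + 3) = .num (L.table U)
  table_le : ∀ U : List α, IsNode T U → L.table U + 4 * (L.kids U).length ≤ free
  edge_label : ∀ U : List α, IsNode T U → ∀ (j : ℕ) (c : α) (V : List α),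
    (L.kids U)[j]? = some (c, V) → mem (L.table U + 4 * j) = .sym c
  edge_target : ∀ U : List α, IsNode T U → ∀ (j : ℕ) (c : α) (V : List α),
    (L.kids U)[j]? = some (c, V) → mem (L.table U + 4 * j + 1) = .num (L.addr V)
  fast_link : ∀ U : List α, IsNode T U → ∀ (j : ℕ) (c : α) (V : List α),
    (L.kids U)[j]? = some (c, V) → ∀ h : ℕ, IsFastLinkHeight T U V h →
      mem (L.table U + 4 * j + 2) = .num (L.addr (slink^[h] U)) ∧
      mem (L.table U + 4 * j + 3) = .num (L.addr (slink^[h] V))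

/-- The string `P` is stored at address `p`, below `free`. -/
def StoresString (P : List α) (mem : ℕ → Word α) (free p : ℕ) : Prop :=
  p + P.length ≤ free ∧ ∀ (i : ℕ) (c : α), P[i]? = some c → mem (p + i) = .sym c

/-- The input of pattern matching: register `0` holds the address of the root of an LST with fast
links, registers `1` and `2` the address and the length of the pattern, register `3` the
address from which on the memory may be used as work space. All else is arbitrary. -/
def IsMatchingInput (T P : List α) (L : Layout α) (free p : ℕ) (x : Config α) : Prop :=
  Stores T x.mem free L ∧ StoresString P x.mem free p ∧ x.pc = 0 ∧
    x.reg 0 = .num (L.addr []) ∧ x.reg 1 = .num p ∧ x.reg 2 = .num P.length ∧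
    x.reg 3 = .num free

end LST

/-!
The matcher walks down the trie along the pattern. An edge of length one is simply followed. The
label of a longer edge `(U, V)` is not stored, but the path from `slink^h(U)` to `slink^h(V)` given
by the fast link spells the same string and consists of at least two edges, so it can be read
recursively: the pair `(slink^h(V), V)` goes onto a stack, the matcher continues at `slink^h(U)`,
and it returns to `V` when it arrives at `slink^h(V)`.

A node strictly inside that path is not of type 1, for otherwise one suffix link earlier the edge
would contain a type-2 node. So it has one child only, and a mismatch there ends the search: the
matched string is followed in `T` by one symbol, and this is not the next symbol of the pattern.

Since every decompaction splits an edge into at least two, an edge of length `m` takes at most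
`3 * m - 2` steps. The decompactions that are still open when the search ends are paid for by the
length of the node at which it started, since each of them shortens the current node. A step of the
matcher is a constant number of instructions and one binary search among the children of a node.
-/

namespace LST

section Nodes

variable {α : Type*} {T U V W X Y u w : List α} {c : α}

lemma iterate_slink (h : ℕ) (U : List α) : slink^[h] U = U.drop h := by
  induction h generalizing U with
  | zero => rfl
  | succ h ih => rw [Function.iterate_succ_apply, ih, slink, List.drop_tail]

lemma slink_append_isSuffix (U V : List α) : slink U ++ V <:+ U ++ V := by
  cases U <;> simp [slink]

lemma IsType1.isInfix (h : IsType1 T U) : U <:+: T := by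
  rcases h with h | ⟨a, _, _, h, _⟩
  · exact h.isInfix
  · exact (List.prefix_append U [a]).isInfix.trans h

lemma IsType1.slink (h : IsType1 T U) : IsType1 T (slink U) := by
  rcases h with h | ⟨a, b, hab, ha, hb⟩
  · exact .inl ((List.tail_suffix U).trans h)
  · exact .inr ⟨a, b, hab, (slink_append_isSuffix U [a]).isInfix.trans ha,
      (slink_append_isSuffix U [b]).isInfix.trans hb⟩

lemma eq_of_not_isType1 {a b : α} (h : ¬ IsType1 T U) (ha : U ++ [a] <:+: T)
    (hb : U ++ [b] <:+: T) : a = b := by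
  by_contra hab
  exact h (.inr ⟨a, b, hab, ha, hb⟩)

lemma isNode_nil (T : List α) : IsNode T [] := .inl (.inl List.nil_suffix)

lemma IsNode.isInfix (h : IsNode T U) : U <:+: T := h.elim IsType1.isInfix And.left

lemma isNode_of_isType1_slink (hU : U <:+: T) (h : IsType1 T (slink U)) : IsNode T U := by
  by_cases h1 : IsType1 T U
  · exact .inl h1
  · exact .inr ⟨hU, h1, h⟩

lemma IsNode.slink (h : IsNode T U) : IsNode T (slink U) :=
  .inl (h.elim IsType1.slink fun h => h.2.2)

lemma IsNode.iterate_slink (h : IsNode T U) (k : ℕ) : IsNode T (LST.slink^[k] U) :=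
  Function.Iterate.rec (IsNode T) h (fun _ h => h.slink) k

namespace IsParent

lemma isNode_left (h : IsParent T U V) : IsNode T U := h.1

lemma isNode_right (h : IsParent T U V) : IsNode T V := h.2.1

lemma isPrefix (h : IsParent T U V) : U <+: V := h.2.2.1

lemma length_lt (h : IsParent T U V) : U.length < V.length :=
  h.isPrefix.length_le.lt_of_ne fun hl => h.2.2.2.1 (h.isPrefix.eq_of_length hl)

lemma eq_or_eq (h : IsParent T U V) (hW : IsNode T W) (hUW : U <+: W) (hWV : W <+: V) :
    W = U ∨ W = V := h.2.2.2.2 W hW hUW hWV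

lemma unique (hU : IsParent T U V) (hW : IsParent T W V) : U = W := by
  rcases List.prefix_or_prefix_of_prefix hU.isPrefix hW.isPrefix with h | h
  · exact ((hU.eq_or_eq hW.isNode_left h hW.isPrefix).resolve_right hW.2.2.2.1).symm
  · exact (hW.eq_or_eq hU.isNode_left h hU.isPrefix).resolve_right hU.2.2.2.1

lemma isPlus_iff (h : IsParent T U V) : IsPlus T V ↔ U.length + 2 ≤ V.length :=
  ⟨fun ⟨_, hW, hl⟩ => h.unique hW ▸ hl, fun hl => ⟨U, h, hl⟩⟩

lemma not_isNode_append (h : IsParent T X (X ++ w)) (hu : u ≠ []) (huw : u <+: w)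
    (hne : u ≠ w) : ¬ IsNode T (X ++ u) := fun hn => by
  rcases h.eq_or_eq hn (List.prefix_append _ _) ((List.prefix_append_right_inj _).2 huw) with h | h
  · exact hu (by simpa using h)
  · exact hne (by simpa using h)

lemma not_isType1_slink_append (h : IsParent T X (X ++ w)) (hX : X ≠ []) (hu : u ≠ [])
    (huw : u <+: w) (hne : u ≠ w) : ¬ IsType1 T (slink X ++ u) := fun h1 => by
  refine h.not_isNode_append hu huw hne (isNode_of_isType1_slink ?_ ?_)
  · exact ((List.prefix_append_right_inj _).2 huw).isInfix.trans h.isNode_right.isInfix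
  · rwa [slink, List.tail_append_of_ne_nil hX]

lemma exists_isChild_append (h : IsParent T X Y) : ∃ c v, Y = X ++ c :: v ∧ IsChild T X c Y := by
  obtain ⟨_ | ⟨c, v⟩, rfl⟩ := h.isPrefix
  · exact absurd h.length_lt (by simp)
  · exact ⟨c, v, rfl, h, v, by simp⟩

end IsParent

/-- Descend from `Y` as long as there is a node strictly between. -/
lemma exists_isParent_isPrefix (hX : IsNode T X) (hY : IsNode T Y) (hXY : X <+: Y) (hne : X ≠ Y) :
    ∃ W, IsParent T X W ∧ W <+: Y := by
  induction hn : Y.length using Nat.strong_induction_on generalizing Y with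
  | _ n ih =>
  by_cases hZ : ∃ Z, IsNode T Z ∧ X <+: Z ∧ Z <+: Y ∧ X ≠ Z ∧ Z ≠ Y
  · obtain ⟨Z, hZ, hXZ, hZY, hneX, hneY⟩ := hZ
    have hlt : Z.length < n :=
      hn ▸ hZY.length_le.lt_of_ne fun hl => hneY (hZY.eq_of_length hl)
    obtain ⟨W, hW, hWZ⟩ := ih Z.length hlt hZ hXZ hneX rfl
    exact ⟨W, hW, hWZ.trans hZY⟩
  · refine ⟨Y, ⟨hX, hY, hXY, hne, fun Z hZ' hXZ hZY => ?_⟩, List.prefix_rfl⟩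
    by_contra! hZne
    exact hZ ⟨Z, hZ', hXZ, hZY, hZne.1.symm, hZne.2⟩

lemma IsChild.append_isInfix (h : IsChild T X c Y) : X ++ [c] <:+: T :=
  h.2.isInfix.trans h.1.isNode_right.isInfix

lemma exists_isChild_of_append_isInfix (hX : IsNode T X) (h : X ++ [c] <:+: T) :
    ∃ Y, IsChild T X c Y := by
  obtain ⟨s, t, rfl⟩ := h
  have hY : IsNode (s ++ (X ++ [c]) ++ t) (X ++ [c] ++ t) := .inl (.inl ⟨s, by simp⟩)
  obtain ⟨W, hW, hWY⟩ := exists_isParent_isPrefix hX hY (by simp) (by simp)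
  exact ⟨W, hW, List.prefix_of_prefix_length_le (List.prefix_append _ _) hWY
    (by simpa using hW.length_lt)⟩

lemma IsChild.exists_cons (h : IsChild T X c (X ++ w)) : ∃ v, w = c :: v := by
  obtain ⟨v, hv⟩ := (List.prefix_append_right_inj _).1 h.2
  exact ⟨v, hv.symm⟩

/-- The child of the root on the way to `Y` has length one, as its suffix link is the root. -/
lemma not_isParent_nil (hY : 2 ≤ Y.length) : ¬ IsParent T [] Y := by
  intro h
  obtain _ | ⟨a, Y⟩ := Y
  · simp at hY
  have ha : [a] <+: a :: Y := by simp
  have hn : IsNode T [a] := isNode_of_isType1_slink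
    (ha.isInfix.trans h.isNode_right.isInfix) (.inl List.nil_suffix)
  rcases h.eq_or_eq hn List.nil_prefix ha with h | h
  · simp at h
  · simp [← List.cons.inj h] at hY

lemma exists_isFastLinkHeight (hl : X.length + 2 ≤ Y.length) :
    ∃ h, IsFastLinkHeight T X Y h := by
  classical
  have hroot : ¬ IsParent T (slink^[X.length] X) (slink^[X.length] Y) := by
    rw [iterate_slink, iterate_slink, List.drop_length]
    exact not_isParent_nil (by rw [List.length_drop]; omega)
  have hex : ∃ h, ¬ IsParent T (slink^[h] X) (slink^[h] Y) := ⟨_, hroot⟩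
  exact ⟨Nat.find hex, Nat.find_min' hex hroot, Nat.find_spec hex,
    fun i hi => not_not.1 (Nat.find_min hex hi)⟩

namespace IsFastLinkHeight

variable {h : ℕ}

lemma pos (hh : IsFastLinkHeight T X Y h) (hp : IsParent T X Y) : 0 < h :=
  Nat.pos_of_ne_zero fun h0 => hh.2.1 (by rwa [h0])

lemma length_drop_lt (hh : IsFastLinkHeight T X Y h) (hp : IsParent T X Y) :
    (X.drop h).length < X.length := by
  rw [List.length_drop]
  exact Nat.sub_lt ((hh.pos hp).trans_le hh.1) (hh.pos hp)

lemma iterate_slink_append (hh : IsFastLinkHeight T X (X ++ w) h) :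
    slink^[h] (X ++ w) = X.drop h ++ w := by
  rw [iterate_slink, List.drop_append_of_le_length hh.1]

lemma not_isType1 (hh : IsFastLinkHeight T X (X ++ w) h) (hp : IsParent T X (X ++ w))
    (hu : u ≠ []) (huw : u <+: w) (hne : u ≠ w) : ¬ IsType1 T (X.drop h ++ u) := by
  obtain ⟨k, rfl⟩ := Nat.exists_eq_add_one.2 (hh.pos hp)
  have hkX : k < X.length := hh.1
  have hpk := hh.2.2 k k.lt_succ_self
  rw [iterate_slink, iterate_slink, List.drop_append_of_le_length hkX.le] at hpk
  have := hpk.not_isType1_slink_append (by simpa using hkX) hu huw hne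
  rwa [slink, List.tail_drop] at this

end IsFastLinkHeight

lemma isLongestPrefix_append {R : List α} (hX : X <:+: T)
    (hR : ∀ c ∈ R.head?, ¬ X ++ [c] <:+: T) : IsLongestPrefix T (X ++ R) X := by
  refine ⟨List.prefix_append _ _, hX, fun Q hQ hQT => ?_⟩
  by_contra! hlt
  obtain ⟨_ | ⟨c, v⟩, rfl⟩ :=
    List.prefix_of_prefix_length_le (List.prefix_append X R) hQ hlt.le
  · simp at hlt
  obtain ⟨z, rfl⟩ := (List.prefix_append_right_inj _).1 hQ
  have hc : X ++ [c] <+: X ++ c :: v := by simp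
  exact hR c (by simp) (hc.isInfix.trans hQT)

end Nodes

section Matcher

variable {α : Type*}

/-- A state of the matcher: the current node, the part of the pattern that has not been matched,
and the stack of the edges that are being decompacted. An entry of the stack holds the node at
which the decompaction of an edge ends, and the lower end of the edge. -/
structure MatchState (α : Type*) where
  node : List α
  rest : List α
  stack : List (List α × List α)

/-- The innermost decompaction does not end at the node `X`. -/
def NotAtTarget (X : List α) (s : List (List α × List α)) : Prop :=
  ∀ e ∈ s.head?, X ≠ e.1

/-- A step of the matcher: it follows an edge of length one, replaces a longer edge by its fast
link, or returns from the end of a fast link to the lower end of the edge. -/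
inductive MatchStep (T : List α) : MatchState α → MatchState α → Prop where
  | advance {X Y Q : List α} {s : List (List α × List α)} {c : α} (hs : NotAtTarget X s)
      (hY : IsChild T X c Y) (hp : ¬ IsPlus T Y) : MatchStep T ⟨X, c :: Q, s⟩ ⟨Y, Q, s⟩
  | push {X Y Q : List α} {s : List (List α × List α)} {c : α} {h : ℕ} (hs : NotAtTarget X s)
      (hY : IsChild T X c Y) (hp : IsPlus T Y) (hh : IsFastLinkHeight T X Y h) :
      MatchStep T ⟨X, c :: Q, s⟩ ⟨slink^[h] X, c :: Q, (slink^[h] Y, Y) :: s⟩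
  | pop {X Y Q : List α} {s : List (List α × List α)} :
      MatchStep T ⟨X, Q, (X, Y) :: s⟩ ⟨Y, Q, s⟩

/-- `MatchSteps T n x y`: the matcher goes from `x` to `y` in exactly `n` steps. -/
inductive MatchSteps (T : List α) : ℕ → MatchState α → MatchState α → Prop where
  | refl (x : MatchState α) : MatchSteps T 0 x x
  | head {n : ℕ} {x y z : MatchState α} (h : MatchStep T x y) (h' : MatchSteps T n y z) :
      MatchSteps T (n + 1) x z

/-- The matcher has no step to make, as no child of the current node carries the next symbol of
the pattern. -/
def MatchState.IsFinal (T : List α) (x : MatchState α) : Prop :=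
  NotAtTarget x.node x.stack ∧ ∀ c ∈ x.rest.head?, ¬ x.node ++ [c] <:+: T

/-- Started at `X` with the rest `Q` of the pattern, the matcher reads the whole string `w`, with at
least `d` steps fewer than three for each symbol. -/
def Reads (T : List α) (d : ℕ) (X w Q : List α) (s : List (List α × List α)) : Prop :=
  ∃ R, Q = w ++ R ∧ ∃ n, n + d ≤ 3 * w.length ∧ MatchSteps T n ⟨X, Q, s⟩ ⟨X ++ w, R, s⟩

/-- Started at `X` with the rest `Q` of the pattern, the matcher reads a prefix `u` of `w` and
stops there, and no longer prefix of `Q` follows `X` in `T`. -/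
def StopsWithin (T X w Q : List α) (s : List (List α × List α)) : Prop :=
  ∃ u R, u <+: w ∧ Q = u ++ R ∧ (∀ c ∈ R.head?, ¬ X ++ u ++ [c] <:+: T) ∧
    ∃ n ≤ 4 * u.length + X.length, ∃ Y s',
      MatchSteps T n ⟨X, Q, s⟩ ⟨Y, R, s'⟩ ∧ MatchState.IsFinal T ⟨Y, R, s'⟩

/-- The two possible outcomes when the path labelled `w` below the node `X` is traversed. -/
def Traverses (T : List α) (d : ℕ) (X w Q : List α) (s : List (List α × List α)) : Prop :=
  Reads T d X w Q s ∨ StopsWithin T X w Q s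

/-- Every edge whose lower end has length at most `N` can be traversed. -/
def TraversesEdges (T : List α) (N : ℕ) : Prop :=
  ∀ ⦃X w : List α⦄ ⦃c : α⦄ (Q : List α) ⦃s : List (List α × List α)⦄,
    (X ++ w).length ≤ N → IsChild T X c (X ++ w) → NotAtTarget X s → Traverses T 2 X w (c :: Q) s

variable {T X Y w Q R : List α} {s : List (List α × List α)} {c : α} {d e N : ℕ}

lemma MatchSteps.trans {m n : ℕ} {x y z : MatchState α} (h : MatchSteps T m x y)
    (h' : MatchSteps T n y z) : MatchSteps T (m + n) x z := by
  induction h with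
  | refl => rwa [Nat.zero_add]
  | head h _ ih =>
    rw [Nat.add_right_comm]
    exact .head h (ih h')

lemma MatchSteps.single {x y : MatchState α} (h : MatchStep T x y) : MatchSteps T 1 x y :=
  .head h (.refl y)

lemma notAtTarget_nil (X : List α) : NotAtTarget X [] := by simp [NotAtTarget]

lemma notAtTarget_append_cons (hw : w ≠ []) : NotAtTarget X ((X ++ w, Y) :: s) := by
  simpa [NotAtTarget] using hw

lemma Reads.append {v : List α} (hw : MatchSteps T N ⟨X, Q, s⟩ ⟨X ++ w, R, s⟩) (hQ : Q = w ++ R)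
    (hN : N + d ≤ 3 * w.length) (hv : Reads T e (X ++ w) v R s) :
    Reads T (d + e) X (w ++ v) Q s := by
  obtain ⟨R', rfl, n, hn, hsteps⟩ := hv
  refine ⟨R', by simp [hQ], N + n, by rw [List.length_append]; omega, ?_⟩
  simpa using hw.trans hsteps

lemma StopsWithin.append {v : List α} (hw : MatchSteps T N ⟨X, Q, s⟩ ⟨X ++ w, R, s⟩)
    (hQ : Q = w ++ R) (hN : N ≤ 3 * w.length) (hv : StopsWithin T (X ++ w) v R s) :
    StopsWithin T X (w ++ v) Q s := by
  obtain ⟨u, R', hu, rfl, hR', n, hn, Y, s', hsteps, hf⟩ := hv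
  refine ⟨w ++ u, R', (List.prefix_append_right_inj _).2 hu, by simp [hQ], by simpa using hR',
    N + n, ?_, Y, s', hw.trans hsteps, hf⟩
  simp only [List.length_append] at hn ⊢
  omega

lemma Traverses.append {v : List α} (hw : Traverses T d X w Q s)
    (hv : ∀ R, Q = w ++ R → Traverses T e (X ++ w) v R s) : Traverses T (d + e) X (w ++ v) Q s := by
  rcases hw with ⟨R, hQ, n, hn, hsteps⟩ | ⟨u, R, hu, h⟩
  · exact (hv R hQ).imp (.append hsteps hQ hn) (.append hsteps hQ (by omega))
  · exact .inr ⟨u, R, hu.trans (List.prefix_append _ _), h⟩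

lemma Traverses.mono (h : Traverses T d X w Q s) (hed : e ≤ d) : Traverses T e X w Q s :=
  h.imp_left fun ⟨R, hQ, n, hn, hsteps⟩ => ⟨R, hQ, n, by omega, hsteps⟩

lemma stopsWithin_of_forall_head (hs : NotAtTarget X s) (hQ : ∀ c ∈ Q.head?, ¬ X ++ [c] <:+: T) :
    StopsWithin T X w Q s :=
  ⟨[], Q, List.nil_prefix, rfl, by simpa using hQ, 0, by simp, X, s, .refl _, hs, hQ⟩

lemma TraversesEdges.traverses_path (hE : TraversesEdges T N) (hN : (X ++ w).length ≤ N)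
    (hX : IsNode T X) (hXw : IsNode T (X ++ w)) (hw : w ≠ [])
    (hbranch : ∀ u, u <+: w → u ≠ w → ¬ IsType1 T (X ++ u)) :
    Traverses T 2 X w Q ((X ++ w, Y) :: s) := by
  induction hn : w.length using Nat.strong_induction_on generalizing X w Q with
  | _ n ih =>
  subst hn
  obtain ⟨Z, hZ, hZw⟩ := exists_isParent_isPrefix hX hXw (by simp) (by simpa using hw)
  obtain ⟨c, v, rfl, hc⟩ := hZ.exists_isChild_append
  obtain ⟨u, rfl⟩ := (List.prefix_append_right_inj _).1 hZw
  have hs : NotAtTarget X ((X ++ (c :: v ++ u), Y) :: s) := notAtTarget_append_cons hw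
  have honly : ∀ a, X ++ [a] <:+: T → a = c := fun a ha =>
    eq_of_not_isType1 (by simpa using hbranch [] List.nil_prefix hw.symm) ha hc.append_isInfix
  by_cases hQc : Q.head? = some c
  · obtain ⟨Q, rfl⟩ : ∃ Q', Q = c :: Q' := ⟨_, List.eq_cons_of_mem_head? hQc⟩
    have hedge := hE Q (hZw.length_le.trans hN) hc hs
    rcases eq_or_ne u [] with rfl | hu
    · simpa using hedge
    refine (hedge.append (e := 2) fun R _ => ?_).mono (by omega)
    have hpath := ih u.length (by simp) (X := X ++ c :: v) (Q := R) (by simpa using hN)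
      hc.1.isNode_right (by simpa using hXw) hu ?_ rfl
    · simpa using hpath
    · intro t ht hne
      simpa using hbranch (c :: v ++ t) ((List.prefix_append_right_inj _).2 ht) (by simpa using hne)
  · exact .inr (stopsWithin_of_forall_head hs fun a ha hinf => hQc (honly a hinf ▸ ha))

/-- The target of a fast link is not an edge, so the path below it consists of at least two edges;
both parts of the path leave two steps to spare. -/
lemma TraversesEdges.traverses_fastLink (hE : TraversesEdges T N) (hN : (X ++ w).length ≤ N)
    (hX : IsNode T X) (hXw : IsNode T (X ++ w)) (hc : [c] <+: w) (hne : ¬ IsParent T X (X ++ w))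
    (hbranch : ∀ u, u ≠ [] → u <+: w → u ≠ w → ¬ IsType1 T (X ++ u)) :
    Traverses T 4 X w (c :: Q) ((X ++ w, Y) :: s) := by
  have hw : w ≠ [] := by rintro rfl; simp at hc
  obtain ⟨Z, hZ, hZw⟩ := exists_isParent_isPrefix hX hXw (by simp) (by simpa using hw)
  obtain ⟨a, v, rfl, ha⟩ := hZ.exists_isChild_append
  obtain ⟨u, rfl⟩ := (List.prefix_append_right_inj _).1 hZw
  obtain rfl : c = a := by simpa using hc
  have hu : u ≠ [] := by
    rintro rfl
    exact hne (by simpa using hZ)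
  have hedge := hE Q (hZw.length_le.trans hN) ha (notAtTarget_append_cons (Y := Y) (s := s) hw)
  refine hedge.append (e := 2) fun R _ => ?_
  have hpath := hE.traverses_path (X := X ++ c :: v) (Q := R) (Y := Y) (s := s)
    (by simpa using hN) ha.1.isNode_right (by simpa using hXw) hu ?_
  · simpa using hpath
  · intro t ht hne
    simpa using hbranch (c :: v ++ t) (by simp) ((List.prefix_append_right_inj _).2 ht)
      (by simpa using hne)

lemma Traverses.of_decompaction {X' : List α} (hX' : X' <:+ X) (hlt : X'.length < X.length)
    (hpush : MatchStep T ⟨X, Q, s⟩ ⟨X', Q, (X' ++ w, X ++ w) :: s⟩)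
    (hlink : Traverses T 4 X' w Q ((X' ++ w, X ++ w) :: s)) : Traverses T 2 X w Q s := by
  rcases hlink with ⟨R, hQ, n, hn, hsteps⟩ | ⟨u, R, hu, hQ, hR, n, hn, Z, s', hsteps, hf⟩
  · exact .inl ⟨R, hQ, n + 1 + 1, by omega, .head hpush (hsteps.trans (.single .pop))⟩
  · refine .inr ⟨u, R, hu, hQ, fun c hc hinf => hR c hc (.trans ?_ hinf), n + 1, by omega, Z, s',
      .head hpush hsteps, hf⟩
    obtain ⟨t, rfl⟩ := hX'
    exact List.IsSuffix.isInfix ⟨t, by simp⟩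

lemma traversesEdges (N : ℕ) : TraversesEdges T N := by
  induction N with
  | zero =>
    intro X w c Q s hN hc
    have := hc.1.length_lt
    omega
  | succ N ih =>
  intro X w c Q s hN hc hs
  obtain ⟨v, rfl⟩ := hc.exists_cons
  rcases eq_or_ne v [] with rfl | hv
  · have hplus : ¬ IsPlus T (X ++ [c]) := by simp [hc.1.isPlus_iff]
    exact .inl ⟨Q, rfl, 1, by simp, .single (.advance hs hc hplus)⟩
  have hl : X.length + 2 ≤ (X ++ c :: v).length := by
    have := List.length_pos_iff.2 hv
    simp only [List.length_append, List.length_cons]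
    omega
  obtain ⟨h, hh⟩ := exists_isFastLinkHeight (T := T) hl
  have hpush := MatchStep.push (Q := Q) hs hc (hc.1.isPlus_iff.2 hl) hh
  have hX' := hc.1.isNode_left.iterate_slink h
  have hY' := hc.1.isNode_right.iterate_slink h
  have hnot := hh.2.1
  rw [hh.iterate_slink_append] at hpush hY' hnot
  rw [iterate_slink] at hpush hX' hnot
  have hlt := hh.length_drop_lt hc.1
  refine .of_decompaction (List.drop_suffix h X) hlt hpush ?_
  refine ih.traverses_fastLink ?_ hX' hY' (by simp) hnot fun u => hh.not_isType1 hc.1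
  rw [List.length_append] at hN ⊢
  omega

theorem exists_matchSteps_isFinal (hX : IsNode T X) (Q : List α) :
    ∃ P' R, X ++ Q = P' ++ R ∧ IsLongestPrefix T (X ++ Q) P' ∧
      ∃ n, n + 3 * X.length ≤ 4 * P'.length ∧ ∃ Y s,
        MatchSteps T n ⟨X, Q, []⟩ ⟨Y, R, s⟩ ∧ MatchState.IsFinal T ⟨Y, R, s⟩ := by
  induction hn : Q.length using Nat.strong_induction_on generalizing X Q with
  | _ n ih =>
  subst hn
  by_cases hQ : ∀ c ∈ Q.head?, ¬ X ++ [c] <:+: T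
  · exact ⟨X, Q, rfl, isLongestPrefix_append hX.isInfix hQ, 0, by omega, X, [], .refl _,
      notAtTarget_nil X, hQ⟩
  push Not at hQ
  obtain ⟨c, hcQ, hc⟩ := hQ
  obtain ⟨Q, rfl⟩ : ∃ Q', Q = c :: Q' := ⟨_, List.eq_cons_of_mem_head? hcQ⟩
  obtain ⟨Y, hY⟩ := exists_isChild_of_append_isInfix hX hc
  obtain ⟨w, rfl⟩ := hY.1.isPrefix
  have : 0 < w.length := by simpa using hY.1.length_lt
  rcases traversesEdges _ Q le_rfl hY (notAtTarget_nil X) with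
    ⟨R, hQ, n, hn, hsteps⟩ | ⟨u, R, hu, hQ, hR, n, hn, Z, s, hsteps, hf⟩
  · rw [hQ] at hsteps ⊢
    obtain ⟨P', R', hP', hlong, m, hm, Z, s, hsteps', hf⟩ :=
      ih R.length (by rw [hQ, List.length_append]; omega) hY.1.isNode_right R rfl
    rw [List.append_assoc] at hP' hlong
    rw [List.length_append] at hm
    exact ⟨P', R', hP', hlong, n + m, by omega, Z, s, hsteps.trans hsteps', hf⟩
  · have huT : X ++ u <:+: T :=
      ((List.prefix_append_right_inj _).2 hu).isInfix.trans hY.1.isNode_right.isInfix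
    rw [hQ, ← List.append_assoc]
    refine ⟨X ++ u, R, rfl, isLongestPrefix_append huT hR, n, ?_, Z, s, hQ ▸ hsteps, hf⟩
    rw [List.length_append]
    omega

end Matcher

end LST

namespace RAM

variable {α : Type*} [LinearOrder α]

lemma run_add (W : ℕ) (prog : Program) (s t : ℕ) (x : Config α) :
    run W prog (s + t) x = (run W prog s x).bind (run W prog t) := by
  induction s generalizing x with
  | zero => simp [run]
  | succ s ih =>
    rw [Nat.add_right_comm, run, run, Option.bind_assoc]
    exact congrArg _ (funext ih)

/-- Within `n` steps from `x` the program arrives without a fault at a configuration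
that satisfies `Q`. -/
def Ensures (W : ℕ) (prog : Program) (n : ℕ) (x : Config α) (Q : Config α → Prop) : Prop :=
  ∃ t ≤ n, ∃ y, run W prog t x = some y ∧ Q y

namespace Ensures

variable {W : ℕ} {prog : Program} {k m n : ℕ} {x : Config α} {Q R : Config α → Prop} {pc : ℕ}
  {reg mem : ℕ → Word α}

lemma of_post (h : Q x) : Ensures W prog n x Q := ⟨0, Nat.zero_le _, x, rfl, h⟩

lemma trans (h : Ensures W prog k x R) (h' : ∀ y, R y → Ensures W prog m y Q)
    (hn : k + m ≤ n) : Ensures W prog n x Q := by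
  obtain ⟨s, hs, y, hy, hR⟩ := h
  obtain ⟨t, ht, z, hz, hQ⟩ := h' y hR
  exact ⟨s + t, by omega, z, by rw [run_add, hy]; exact hz, hQ⟩

lemma mono (h : Ensures W prog m x Q) (hmn : m ≤ n) : Ensures W prog n x Q :=
  let ⟨t, ht, hQ⟩ := h
  ⟨t, ht.trans hmn, hQ⟩

lemma head {i : Instr} {y : Config α} (hi : prog[x.pc]? = some i) (hy : i.exec W x = some y)
    (h : Ensures W prog n y Q) : Ensures W prog (n + 1) x Q := by
  obtain ⟨t, ht, z, hz, hQ⟩ := h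
  refine ⟨t + 1, by omega, z, ?_, hQ⟩
  rw [run, step, hi, Option.bind_some, hy]
  exact hz

lemma const {d c : ℕ} (hi : prog[pc]? = some (.const d c)) (hc : c ≤ W)
    (h : Ensures W prog n ⟨pc + 1, Function.update reg d (.num c), mem⟩ Q) :
    Ensures W prog (n + 1) ⟨pc, reg, mem⟩ Q :=
  head hi (by simp [Instr.exec, hc, Config.set]) h

lemma move {d s : ℕ} (w : Word α) (hi : prog[pc]? = some (.move d s)) (hw : reg s = w)
    (h : Ensures W prog n ⟨pc + 1, Function.update reg d w, mem⟩ Q) :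
    Ensures W prog (n + 1) ⟨pc, reg, mem⟩ Q :=
  head hi (by simp [Instr.exec, hw, Config.set]) h

lemma add {d a b : ℕ} (u v : ℕ) (hi : prog[pc]? = some (.add d a b))
    (hu : reg a = .num u) (hv : reg b = .num v) (huv : u + v ≤ W)
    (h : Ensures W prog n ⟨pc + 1, Function.update reg d (.num (u + v)), mem⟩ Q) :
    Ensures W prog (n + 1) ⟨pc, reg, mem⟩ Q :=
  head hi (by simp [Instr.exec, hu, hv, huv, Config.set]) h

lemma sub {d a b : ℕ} (u v : ℕ) (hi : prog[pc]? = some (.sub d a b))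
    (hu : reg a = .num u) (hv : reg b = .num v)
    (h : Ensures W prog n ⟨pc + 1, Function.update reg d (.num (u - v)), mem⟩ Q) :
    Ensures W prog (n + 1) ⟨pc, reg, mem⟩ Q :=
  head hi (by simp [Instr.exec, hu, hv, Config.set]) h

lemma half {d a : ℕ} (u : ℕ) (hi : prog[pc]? = some (.half d a)) (hu : reg a = .num u)
    (h : Ensures W prog n ⟨pc + 1, Function.update reg d (.num (u / 2)), mem⟩ Q) :
    Ensures W prog (n + 1) ⟨pc, reg, mem⟩ Q :=
  head hi (by simp [Instr.exec, hu, Config.set]) h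

lemma load {d a : ℕ} (u : ℕ) (w : Word α) (hi : prog[pc]? = some (.load d a))
    (hu : reg a = .num u) (hw : mem u = w)
    (h : Ensures W prog n ⟨pc + 1, Function.update reg d w, mem⟩ Q) :
    Ensures W prog (n + 1) ⟨pc, reg, mem⟩ Q :=
  head hi (by simp [Instr.exec, hu, hw, Config.set]) h

lemma store {a s : ℕ} (u : ℕ) (w : Word α) (hi : prog[pc]? = some (.store a s))
    (hu : reg a = .num u) (hw : reg s = w)
    (h : Ensures W prog n ⟨pc + 1, reg, Function.update mem u w⟩ Q) :
    Ensures W prog (n + 1) ⟨pc, reg, mem⟩ Q :=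
  head hi (by simp [Instr.exec, hu, hw]) h

lemma jump {l : ℕ} (hi : prog[pc]? = some (.jump l))
    (h : Ensures W prog n ⟨l, reg, mem⟩ Q) : Ensures W prog (n + 1) ⟨pc, reg, mem⟩ Q :=
  head hi (by simp [Instr.exec, Config.branch]) h

lemma jumpEq_pos {a b l : ℕ} (hi : prog[pc]? = some (.jumpEq a b l)) (hab : reg a = reg b)
    (h : Ensures W prog n ⟨l, reg, mem⟩ Q) : Ensures W prog (n + 1) ⟨pc, reg, mem⟩ Q :=
  head hi (by simp [Instr.exec, Config.branch, hab]) h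

lemma jumpEq_neg {a b l : ℕ} (hi : prog[pc]? = some (.jumpEq a b l)) (hab : reg a ≠ reg b)
    (h : Ensures W prog n ⟨pc + 1, reg, mem⟩ Q) : Ensures W prog (n + 1) ⟨pc, reg, mem⟩ Q :=
  head hi (by simp [Instr.exec, Config.branch, hab]) h

lemma jumpLt_sym_pos {a b l : ℕ} (c e : α) (hi : prog[pc]? = some (.jumpLt a b l))
    (ha : reg a = .sym c) (hb : reg b = .sym e) (hce : c < e)
    (h : Ensures W prog n ⟨l, reg, mem⟩ Q) : Ensures W prog (n + 1) ⟨pc, reg, mem⟩ Q :=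
  head hi (by simp [Instr.exec, Config.branch, ha, hb, hce]) h

lemma jumpLt_sym_neg {a b l : ℕ} (c e : α) (hi : prog[pc]? = some (.jumpLt a b l))
    (ha : reg a = .sym c) (hb : reg b = .sym e) (hce : ¬ c < e)
    (h : Ensures W prog n ⟨pc + 1, reg, mem⟩ Q) : Ensures W prog (n + 1) ⟨pc, reg, mem⟩ Q :=
  head hi (by simp [Instr.exec, Config.branch, ha, hb, hce]) h

end Ensures

end RAM

namespace LST

section Invariant

variable {α : Type*} {T P : List α} {st st' : MatchState α}

/-- The invariant of the matcher on the pattern `P`. By `length`, what is missing from the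
current node is what the open decompactions will restore when they return. -/
structure MatchState.IsValid (T P : List α) (st : MatchState α) : Prop where
  node : IsNode T st.node
  stack : ∀ e ∈ st.stack, IsNode T e.1 ∧ IsNode T e.2 ∧ e.1.length < e.2.length
  rest : st.rest <:+ P
  length : st.node.length + (st.stack.map fun e => e.2.length - e.1.length).sum +
    st.rest.length = P.length

lemma isValid_init (T P : List α) : MatchState.IsValid T P ⟨[], P, []⟩ :=
  ⟨isNode_nil T, by simp, List.suffix_rfl, by simp⟩

lemma MatchState.IsValid.stack_length_le (h : st.IsValid T P) : st.stack.length ≤ P.length := by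
  have hone : ∀ i ∈ st.stack.map (fun e => e.2.length - e.1.length), 1 ≤ i := by
    simp only [List.mem_map, forall_exists_index, and_imp, forall_apply_eq_imp_iff₂]
    exact fun e he => Nat.sub_pos_of_lt (h.stack e he).2.2
  have hsum := List.length_le_sum_of_one_le _ hone
  rw [List.length_map] at hsum
  have := h.length
  omega

lemma MatchStep.isValid (h : MatchStep T st st') (hv : st.IsValid T P) : st'.IsValid T P := by
  obtain ⟨hX, hstack, hrest, hlen⟩ := hv
  cases h with
  | advance hs hY hp =>
    rw [hY.1.isPlus_iff] at hp
    have := hY.1.length_lt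
    refine ⟨hY.1.isNode_right, hstack, (List.suffix_cons _ _).trans hrest, ?_⟩
    simp only [List.length_cons] at hlen ⊢
    omega
  | @push X Y Q s c h hs hY hp hh =>
    have hpos := hh.pos hY.1
    have hle := hh.1
    have hlt := hY.1.length_lt
    refine ⟨hX.iterate_slink h, List.forall_mem_cons.2
      ⟨⟨hY.1.isNode_right.iterate_slink h, hY.1.isNode_right, ?_⟩, hstack⟩, hrest, ?_⟩
    · simp only [iterate_slink, List.length_drop]
      omega
    · simp only [iterate_slink, List.length_drop, List.map_cons, List.sum_cons] at hlen ⊢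
      omega
  | pop =>
    obtain ⟨⟨-, hY, hlt⟩, hstack⟩ := List.forall_mem_cons.1 hstack
    dsimp only at hlt
    refine ⟨hY, hstack, hrest, ?_⟩
    simp only [List.map_cons, List.sum_cons] at hlen ⊢
    omega

end Invariant

section SearchRange

variable {α β : Type*} [LinearOrder α] {l : List (α × β)} {c : α} {lo hi mid : ℕ} {e : α × β}

/-- The entries of `l` before position `lo` have keys below `c`, those from position `hi` on have
keys above `c`. -/
structure IsSearchRange (l : List (α × β)) (c : α) (lo hi : ℕ) : Prop where
  le : lo ≤ hi
  le_length : hi ≤ l.length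
  lt_of_mem_take : ∀ e ∈ l.take lo, e.1 < c
  lt_of_mem_drop : ∀ e ∈ l.drop hi, c < e.1

lemma isSearchRange_zero_length (l : List (α × β)) (c : α) : IsSearchRange l c 0 l.length :=
  ⟨Nat.zero_le _, le_rfl, by simp, by simp⟩

namespace IsSearchRange

lemma raise_lower (h : IsSearchRange l c lo hi) (hl : l.Pairwise fun x y => x.1 < y.1)
    (hmid : mid < hi) (he : l[mid]? = some e) (hec : e.1 < c) :
    IsSearchRange l c (mid + 1) hi := by
  refine ⟨hmid, h.le_length, fun a ha => ?_, h.lt_of_mem_drop⟩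
  have htake : l.take (mid + 1) = l.take mid ++ [e] := by rw [List.take_add_one, he]; rfl
  have hsorted := hl.sublist (List.take_sublist (mid + 1) l)
  rw [htake] at ha hsorted
  rcases List.mem_append.1 ha with ha | ha
  · exact ((List.pairwise_append.1 hsorted).2.2 a ha e (List.mem_singleton_self e)).trans hec
  · rwa [List.mem_singleton.1 ha]

lemma reduce_upper (h : IsSearchRange l c lo hi) (hl : l.Pairwise fun x y => x.1 < y.1)
    (hlo : lo ≤ mid) (he : l[mid]? = some e) (hec : c < e.1) : IsSearchRange l c lo mid := by
  obtain ⟨hmid, rfl⟩ := List.getElem?_eq_some_iff.1 he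
  refine ⟨hlo, hmid.le, h.lt_of_mem_take, fun a ha => ?_⟩
  have hsorted := hl.sublist (List.drop_sublist mid l)
  rw [List.drop_eq_getElem_cons hmid] at ha hsorted
  rcases List.mem_cons.1 ha with rfl | ha
  · exact hec
  · exact hec.trans (List.rel_of_pairwise_cons hsorted ha)

lemma not_mem (h : IsSearchRange l c lo lo) (b : β) : (c, b) ∉ l := fun hb => by
  rw [← List.take_append_drop lo l, List.mem_append] at hb
  exact hb.elim (fun hb => lt_irrefl _ (h.lt_of_mem_take _ hb))
    fun hb => lt_irrefl _ (h.lt_of_mem_drop _ hb)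

end IsSearchRange

end SearchRange

section Storage

open RAM

variable {α : Type*} {T P X Y : List α} {L : Layout α} {free p : ℕ} {mem mem' : ℕ → Word α}
  {s : List (List α × List α)} {c : α}

/-- The stack of the matcher is stored from `free` on, above the sentinel `free`, which is not the
address of a node. -/
def StoresStack (L : Layout α) (free : ℕ) (mem : ℕ → Word α) : List (List α × List α) → Prop
  | [] => mem free = .num free
  | e :: s => mem (free + 2 * (s.length + 1)) = .num (L.addr e.1) ∧
      mem (free + 2 * (s.length + 1) + 1) = .num (L.addr e.2) ∧ StoresStack L free mem s

lemma StoresStack.congr (h : StoresStack L free mem s)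
    (hmem : ∀ a < free + 2 * (s.length + 1), mem' a = mem a) : StoresStack L free mem' s := by
  induction s with
  | nil => rwa [StoresStack, hmem free (by simp)]
  | cons e s ih =>
    rw [List.length_cons] at hmem
    obtain ⟨h₁, h₂, hs⟩ := h
    refine ⟨?_, ?_, ih hs fun a ha => hmem a (by omega)⟩
    · rwa [hmem _ (by omega)]
    · rwa [hmem _ (by omega)]

lemma StoresStack.push (h : StoresStack L free mem s) (X Y : List α) :
    StoresStack L free (Function.update (Function.update mem (free + 2 * (s.length + 1))
      (.num (L.addr X))) (free + 2 * (s.length + 1) + 1) (.num (L.addr Y))) ((X, Y) :: s) := by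
  refine ⟨by simp, by simp, h.congr fun a ha => ?_⟩
  rw [Function.update_of_ne (by omega), Function.update_of_ne ha.ne]

lemma StoresString.congr (h : StoresString P mem free p) (hmem : ∀ a < free, mem' a = mem a) :
    StoresString P mem' free p := by
  refine ⟨h.1, fun i c hc => ?_⟩
  have hi := (List.getElem?_eq_some_iff.1 hc).1
  have := h.1
  rw [hmem _ (by omega), h.2 i c hc]

lemma StoresString.apply_of_cons_isSuffix {Q : List α} (h : StoresString P mem free p)
    (hQ : c :: Q <:+ P) : mem (p + (P.length - (c :: Q).length)) = .sym c := by
  obtain ⟨t, rfl⟩ := hQ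
  exact h.2 _ c (by simp)

variable [LinearOrder α]

namespace Stores

lemma congr (h : Stores T mem free L) (hmem : ∀ a < free, mem' a = mem a) :
    Stores T mem' free L := by
  have hrecord : ∀ U, IsNode T U → ∀ i < 4, mem' (L.addr U + i) = mem (L.addr U + i) :=
    fun U hU i hi => hmem _ (by have := h.addr_lt U hU; omega)
  have hentry : ∀ U, IsNode T U → ∀ j e, (L.kids U)[j]? = some e → ∀ i < 4,
      mem' (L.table U + 4 * j + i) = mem (L.table U + 4 * j + i) := fun U hU j e he i hi => by
    have hj := (List.getElem?_eq_some_iff.1 he).1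
    have := h.table_le U hU
    exact hmem _ (by omega)
  refine ⟨h.addr_inj, h.addr_lt, ?_, ?_, ?_, h.kids_sorted, h.mem_kids, ?_, ?_, h.table_le,
    ?_, ?_, ?_⟩
  · exact fun U hU hp => (hrecord U hU 0 (by simp)).trans (h.plus_true U hU hp)
  · exact fun U hU hp => (hrecord U hU 0 (by simp)).trans (h.plus_false U hU hp)
  · exact fun U hU hne => (hrecord U hU 1 (by simp)).trans (h.suffix_link U hU hne)
  · exact fun U hU => (hrecord U hU 2 (by simp)).trans (h.kids_length U hU)
  · exact fun U hU => (hrecord U hU 3 (by simp)).trans (h.table_addr U hU)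
  · exact fun U hU j c V he => (hentry U hU j _ he 0 (by simp)).trans (h.edge_label U hU j c V he)
  · exact fun U hU j c V he => (hentry U hU j _ he 1 (by simp)).trans (h.edge_target U hU j c V he)
  · exact fun U hU j c V he k hk =>
      ⟨(hentry U hU j _ he 2 (by simp)).trans (h.fast_link U hU j c V he k hk).1,
        (hentry U hU j _ he 3 (by simp)).trans (h.fast_link U hU j c V he k hk).2⟩

lemma nodup_labels (h : Stores T mem free L) (hX : IsNode T X) :
    ((L.kids X).map Prod.fst).Nodup :=
  List.pairwise_map.2 ((h.kids_sorted X hX).imp ne_of_lt)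

lemma kids_length_le [Fintype α] (h : Stores T mem free L) (hX : IsNode T X) :
    (L.kids X).length ≤ Fintype.card α := by
  simpa using (h.nodup_labels hX).length_le_card

lemma child_unique {Y' : List α} (h : Stores T mem free L) (hY : IsChild T X c Y)
    (hY' : IsChild T X c Y') : Y = Y' := by
  have hX := hY.1.isNode_left
  exact congrArg Prod.snd (List.inj_on_of_nodup_map (h.nodup_labels hX)
    ((h.mem_kids X hX c Y).2 hY) ((h.mem_kids X hX c Y').2 hY') rfl)

end Stores

lemma StoresStack.exists_top (h : StoresStack L free mem s) (hS : Stores T mem free L)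
    (hnode : ∀ e ∈ s, IsNode T e.1) (hX : IsNode T X) (hs : NotAtTarget X s) :
    ∃ t, mem (free + 2 * s.length) = .num t ∧ t ≠ L.addr X := by
  cases s with
  | nil =>
    have := hS.addr_lt X hX
    exact ⟨free, h, by omega⟩
  | cons e s =>
    exact ⟨_, h.1, fun heq => hs e rfl (hS.addr_inj _ _ (hnode e (by simp)) hX heq).symm⟩

end Storage

section Program

open RAM

/-- The matcher as a program. Registers: `0` the current node, `1` and `2` address and length of
the pattern, `3` the bottom of the stack, `4` the number of matched symbols, `5` the top of the
stack, `6` to `8` the constants 1, 2 and 3, `9` the next symbol of the pattern, `10` the table of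
outgoing edges, `11` and `12` the bounds of a binary search, `14` an entry of that table,
`16` the child. -/
def matcherProgram : Program :=
  [.const 4 0,
   .const 6 1,
   .const 7 2,
   .const 8 3,
   .move 5 3,
   .store 5 3,
   -- 6: the loop
   .load 15 5,
   .jumpEq 15 0 45,
   .jumpEq 4 2 49,
   .add 15 1 4,
   .load 9 15,
   .add 15 0 8,
   .load 10 15,
   .add 15 0 7,
   .load 12 15,
   .const 11 0,
   -- 16: binary search
   .jumpEq 11 12 49,
   .add 13 11 12,
   .half 13 13,
   .add 14 13 13,
   .add 14 14 14,
   .add 14 14 10,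
   .load 15 14,
   .jumpEq 15 9 29,
   .jumpLt 15 9 27,
   .move 12 13,
   .jump 16,
   .add 11 13 6,
   .jump 16,
   -- 29: a child is found
   .add 15 14 6,
   .load 16 15,
   .load 17 16,
   .jumpEq 17 6 36,
   .move 0 16,
   .add 4 4 6,
   .jump 6,
   -- 36: follow a fast link
   .add 15 14 7,
   .load 0 15,
   .add 15 14 8,
   .load 15 15,
   .add 5 5 7,
   .store 5 15,
   .add 15 5 6,
   .store 15 16,
   .jump 6,
   -- 45: return from a fast link
   .add 15 5 6,
   .load 0 15,
   .sub 5 5 7,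
   .jump 6,
   -- 49: the end
   .move 0 4,
   .halt]

/-- The registers and the memory, at the head of the loop of the program, stand for the state `st`
of the matcher. The registers from 9 on are scratch. -/
structure Represents {α : Type*} [LinearOrder α] (T P : List α) (L : Layout α) (free p : ℕ)
    (reg mem : ℕ → Word α) (st : MatchState α) : Prop where
  stores : Stores T mem free L
  storesString : StoresString P mem free p
  storesStack : StoresStack L free mem st.stack
  valid : st.IsValid T P
  node : reg 0 = .num (L.addr st.node)
  pattern : reg 1 = .num p
  length : reg 2 = .num P.length
  matched : reg 4 = .num (P.length - st.rest.length)
  top : reg 5 = .num (free + 2 * st.stack.length)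
  one : reg 6 = .num 1
  two : reg 7 = .num 2
  three : reg 8 = .num 3

/-- The binary search for the child of `st.node` with label `c` has been narrowed down to the
positions from `lo` to `hi`. -/
structure IsSearching {α : Type*} [LinearOrder α] (T P : List α) (L : Layout α) (free p : ℕ)
    (reg mem : ℕ → Word α) (st : MatchState α) (c : α) (lo hi : ℕ) : Prop extends
    Represents T P L free p reg mem st where
  range : IsSearchRange (L.kids st.node) c lo hi
  symbol : reg 9 = .sym c
  table : reg 10 = .num (L.table st.node)
  lower : reg 11 = .num lo
  upper : reg 12 = .num hi

/-- Register 14 points to the entry for the child with label `c` in the table of `st.node`. -/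
def PointsToEntry {α : Type*} (L : Layout α) (reg : ℕ → Word α) (X : List α) (c : α)
    (Y : List α) : Prop :=
  ∃ j, (L.kids X)[j]? = some (c, Y) ∧ reg 14 = .num (L.table X + 4 * j)

/-- The result of the binary search for the child of `st.node` with label `c`: either there is none
and the program goes to its end, or the program is about to use the entry of a child. -/
def IsLookupResult {α : Type*} [LinearOrder α] (T P : List α) (L : Layout α) (free p : ℕ)
    (st : MatchState α) (c : α) (x : Config α) : Prop :=
  Represents T P L free p x.reg x.mem st ∧
    (x.pc = 49 ∧ (∀ Y, ¬ IsChild T st.node c Y) ∨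
      x.pc = 29 ∧ ∃ Y, IsChild T st.node c Y ∧ PointsToEntry L x.reg st.node c Y)

variable {α : Type*} [LinearOrder α] {T P : List α} {L : Layout α} {free p W : ℕ}
  {reg mem : ℕ → Word α} {st st' : MatchState α} {c : α} {Y : List α} {lo hi d n : ℕ}

@[simp]
lemma represents_update {r : ℕ} {w : Word α} (hr : 8 < r) :
    Represents T P L free p (Function.update reg r w) mem st ↔
      Represents T P L free p reg mem st := by
  have hne : ∀ i ≤ 8, Function.update reg r w i = reg i := fun i hi =>
    Function.update_of_ne (by omega) _ _
  constructor <;> rintro ⟨h₁, h₂, h₃, h₄, h₅, h₆, h₇, h₈, h₉, h₁₀, h₁₁, h₁₂⟩ <;>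
    constructor <;> simp_all

/-- The stack has at most `P.length ≤ free` entries, of two cells each. -/
lemma Represents.top_le (hx : Represents T P L free p reg mem st) :
    free + 2 * st.stack.length + 3 ≤ 4 * (free + 1) := by
  have := hx.valid.stack_length_le
  have := hx.storesString.1
  omega

lemma IsSearching.ensures_probe {mid : ℕ} {e : α × List α}
    (hx : IsSearching T P L free p reg mem st c lo hi) (hW : 4 * (free + 1) ≤ W) (hlt : lo < hi)
    (hmid : (lo + hi) / 2 = mid) (he : (L.kids st.node)[mid]? = some e) :
    Ensures W matcherProgram 7 ⟨16, reg, mem⟩ fun y => y.pc = 23 ∧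
      IsSearching T P L free p y.reg y.mem st c lo hi ∧ y.reg 13 = .num mid ∧
        y.reg 14 = .num (L.table st.node + 4 * mid) ∧ y.reg 15 = .sym e.1 := by
  have hX := hx.valid.node
  have := hx.stores.table_le _ hX
  have := hx.range.le_length
  refine .jumpEq_neg rfl (by simpa [hx.lower, hx.upper] using hlt.ne) ?_
  refine .add lo hi rfl (by simp [hx.lower]) (by simp [hx.upper]) (by omega) ?_
  refine .half (lo + hi) rfl (by simp) ?_
  rw [hmid]
  refine .add mid mid rfl (by simp) (by simp) (by omega) ?_
  refine .add (mid + mid) (mid + mid) rfl (by simp) (by simp) (by omega) ?_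
  refine .add (mid + mid + (mid + mid)) (L.table st.node) rfl (by simp) (by simp [hx.table])
    (by omega) ?_
  rw [show mid + mid + (mid + mid) + L.table st.node = L.table st.node + 4 * mid by ring]
  refine .load _ (.sym e.1) rfl (by simp) (hx.stores.edge_label _ hX mid e.1 e.2 he) ?_
  refine .of_post ⟨rfl, ⟨by simpa using hx.toRepresents, hx.range, ?_, ?_, ?_, ?_⟩, ?_⟩
  all_goals simp [hx.symbol, hx.table, hx.lower, hx.upper]

lemma IsSearching.ensures_round (hx : IsSearching T P L free p reg mem st c lo hi)
    (hW : 4 * (free + 1) ≤ W) (hlt : lo < hi) :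
    Ensures W matcherProgram 11 ⟨16, reg, mem⟩ fun y =>
      IsLookupResult T P L free p st c y ∨ y.pc = 16 ∧ ∃ lo' hi', 2 * (hi' - lo') ≤ hi - lo ∧
        IsSearching T P L free p y.reg y.mem st c lo' hi' := by
  obtain ⟨mid, hmid⟩ : ∃ mid, (lo + hi) / 2 = mid := ⟨_, rfl⟩
  have hle := hx.range.le_length
  obtain ⟨⟨b, V⟩, he⟩ : ∃ e, (L.kids st.node)[mid]? = some e :=
    ⟨_, List.getElem?_eq_getElem (by omega)⟩
  refine (hx.ensures_probe hW hlt hmid he).trans (m := 4) ?_ le_rfl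
  rintro ⟨_, reg, mem⟩ ⟨rfl, hx, h₁₃, h₁₄, h₁₅⟩
  have hX := hx.valid.node
  have hsorted := hx.stores.kids_sorted _ hX
  dsimp only at hx h₁₃ h₁₄ h₁₅
  by_cases hbc : b = c
  · subst hbc
    have hV := (hx.stores.mem_kids _ hX b V).1 (List.mem_of_getElem? he)
    exact .jumpEq_pos rfl (by rw [h₁₅, hx.symbol])
      (.of_post (.inl ⟨hx.toRepresents, .inr ⟨rfl, V, hV, mid, he, h₁₄⟩⟩))
  refine .jumpEq_neg rfl (by simpa [h₁₅, hx.symbol] using hbc) ?_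
  rcases lt_or_gt_of_ne hbc with hbc | hbc
  · refine .jumpLt_sym_pos b c rfl h₁₅ hx.symbol hbc ?_
    have := hx.stores.table_le _ hX
    refine .add mid 1 rfl h₁₃ hx.one (by omega) (.jump rfl ?_)
    refine .of_post (.inr ⟨rfl, mid + 1, hi, by omega, by simpa using hx.toRepresents,
      hx.range.raise_lower hsorted (by omega) he hbc, ?_, ?_, ?_, ?_⟩)
    all_goals simp [hx.symbol, hx.table, hx.upper]
  · refine .jumpLt_sym_neg b c rfl h₁₅ hx.symbol hbc.not_gt (.move _ rfl h₁₃ (.jump rfl ?_))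
    refine .of_post (.inr ⟨rfl, lo, mid, by omega, by simpa using hx.toRepresents,
      hx.range.reduce_upper hsorted (by omega) he hbc, ?_, ?_, ?_, ?_⟩)
    all_goals simp [hx.symbol, hx.table, hx.lower]

lemma IsSearching.ensures_search (hx : IsSearching T P L free p reg mem st c lo hi)
    (hW : 4 * (free + 1) ≤ W) (hn : hi - lo < 2 ^ n) :
    Ensures W matcherProgram (11 * n + 1) ⟨16, reg, mem⟩ (IsLookupResult T P L free p st c) := by
  induction n generalizing lo hi reg mem with
  | zero =>
    obtain rfl : lo = hi := by
      have := hx.range.le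
      omega
    refine .jumpEq_pos rfl (hx.lower.trans hx.upper.symm)
      (.of_post ⟨hx.toRepresents, .inl ⟨rfl, fun Y hY => ?_⟩⟩)
    exact hx.range.not_mem Y ((hx.stores.mem_kids _ hx.valid.node c Y).2 hY)
  | succ n ih =>
    rcases hx.range.le.eq_or_lt with rfl | hlt
    · exact (ih hx (by simp)).mono (by omega)
    refine (hx.ensures_round hW hlt).trans (m := 11 * n + 1) ?_ (by omega)
    rintro ⟨_, reg, mem⟩ (h | ⟨rfl, lo', hi', hhalf, h⟩)
    · exact .of_post h
    · exact ih h (by rw [pow_succ] at hn; omega)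

lemma Represents.ensures_notAtTarget (hx : Represents T P L free p reg mem st)
    (hs : NotAtTarget st.node st.stack) :
    Ensures W matcherProgram 2 ⟨6, reg, mem⟩ fun y => y.pc = 8 ∧
      Represents T P L free p y.reg y.mem st := by
  obtain ⟨t, ht, hne⟩ := hx.storesStack.exists_top hx.stores
    (fun e he => (hx.valid.stack e he).1) hx.valid.node hs
  refine .load _ _ rfl hx.top ht (.jumpEq_neg rfl (by simp [hx.node, hne]) ?_)
  exact .of_post ⟨rfl, by simpa using hx⟩

lemma Represents.ensures_lookup {Q : List α} (hx : Represents T P L free p reg mem st)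
    (hW : 4 * (free + 1) ≤ W) (hd : (L.kids st.node).length ≤ d) (hc : st.rest = c :: Q) :
    Ensures W matcherProgram (11 * (Nat.log 2 d + 1) + 9) ⟨8, reg, mem⟩
      (IsLookupResult T P L free p st c) := by
  have hX := hx.valid.node
  have hsuffix := hx.valid.rest
  have hmatched := hx.matched
  rw [hc] at hsuffix hmatched
  have := hsuffix.length_le
  have := hx.storesString.1
  have := hx.stores.addr_lt _ hX
  have hlt : P.length - (c :: Q).length < P.length := by rw [List.length_cons] at *; omega
  refine .jumpEq_neg rfl (by simpa [hmatched, hx.length] using hlt.ne) ?_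
  refine .add p _ rfl (by simp [hx.pattern]) hmatched (by omega) ?_
  refine .load _ (.sym c) rfl (by simp)
    (hx.storesString.apply_of_cons_isSuffix hsuffix) ?_
  refine .add (L.addr st.node) 3 rfl (by simp [hx.node]) (by simp [hx.three]) (by omega) ?_
  refine .load (L.addr st.node + 3) _ rfl (by simp) (hx.stores.table_addr _ hX) ?_
  refine .add (L.addr st.node) 2 rfl (by simp [hx.node]) (by simp [hx.two]) (by omega) ?_
  refine .load (L.addr st.node + 2) _ rfl (by simp) (hx.stores.kids_length _ hX) ?_
  refine .const rfl (Nat.zero_le _) ?_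
  refine IsSearching.ensures_search (lo := 0) (hi := (L.kids st.node).length)
    ⟨by simpa using hx, isSearchRange_zero_length _ _, ?_, ?_, ?_, ?_⟩ hW
    (hd.trans_lt (Nat.lt_pow_succ_log_self one_lt_two d))
  all_goals simp

lemma Represents.ensures_child {Q : List α} (hx : Represents T P L free p reg mem st)
    (hW : 4 * (free + 1) ≤ W) (hd : (L.kids st.node).length ≤ d)
    (hs : NotAtTarget st.node st.stack) (hc : st.rest = c :: Q) (hY : IsChild T st.node c Y) :
    Ensures W matcherProgram (11 * (Nat.log 2 d + 1) + 14) ⟨6, reg, mem⟩ fun y => y.pc = 32 ∧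
      Represents T P L free p y.reg y.mem st ∧ PointsToEntry L y.reg st.node c Y ∧
        y.reg 16 = .num (L.addr Y) ∧ y.reg 17 = y.mem (L.addr Y) := by
  refine (hx.ensures_notAtTarget hs).trans (m := 11 * (Nat.log 2 d + 1) + 12) ?_ (by omega)
  rintro ⟨_, reg, mem⟩ ⟨rfl, hx⟩
  refine (hx.ensures_lookup hW hd hc).trans (m := 3) ?_ (by omega)
  rintro ⟨_, reg, mem⟩ ⟨hx, ⟨-, hnone⟩ | ⟨rfl, V, hV, j, hj, h₁₄⟩⟩
  · exact absurd hY (hnone Y)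
  dsimp only at hx h₁₄
  obtain rfl := hx.stores.child_unique hY hV
  have hX := hx.valid.node
  have := (List.getElem?_eq_some_iff.1 hj).1
  have := hx.stores.table_le _ hX
  refine .add _ 1 rfl h₁₄ hx.one (by omega) ?_
  refine .load _ _ rfl (by simp) (hx.stores.edge_target _ hX j c Y hj) ?_
  refine .load (L.addr Y) _ rfl (by simp) rfl ?_
  exact .of_post ⟨rfl, by simpa using hx, ⟨j, hj, by simpa using h₁₄⟩, by simp, by simp⟩

lemma Represents.ensures_advance {Q X : List α} {s : List (List α × List α)}
    (hx : Represents T P L free p reg mem ⟨X, c :: Q, s⟩) (hW : 4 * (free + 1) ≤ W)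
    (hv : MatchState.IsValid T P ⟨Y, Q, s⟩) (hp : ¬ IsPlus T Y) (h₁₆ : reg 16 = .num (L.addr Y))
    (h₁₇ : reg 17 = mem (L.addr Y)) :
    Ensures W matcherProgram 4 ⟨32, reg, mem⟩ fun y => y.pc = 6 ∧
      Represents T P L free p y.reg y.mem ⟨Y, Q, s⟩ := by
  rw [hx.stores.plus_false Y hv.node hp] at h₁₇
  have hrest := hx.valid.rest.length_le
  have := hx.storesString.1
  rw [List.length_cons] at hrest
  have hmatched : P.length - (c :: Q).length + 1 = P.length - Q.length := by
    rw [List.length_cons]; omega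
  refine .jumpEq_neg rfl (by simp [h₁₇, hx.one]) (.move _ rfl h₁₆ ?_)
  refine .add (P.length - (c :: Q).length) 1 rfl (by simp [hx.matched]) (by simp [hx.one])
    (by omega) (.jump rfl ?_)
  refine .of_post ⟨rfl, hx.stores, hx.storesString, hx.storesStack, hv, ?_, ?_, ?_,
    by simpa using hmatched, ?_, ?_, ?_, ?_⟩
  all_goals simp [hx.pattern, hx.length, hx.top, hx.one, hx.two, hx.three]

lemma Represents.ensures_push {Q X : List α} {s : List (List α × List α)} {h : ℕ}
    (hx : Represents T P L free p reg mem ⟨X, c :: Q, s⟩) (hW : 4 * (free + 1) ≤ W)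
    (hv : MatchState.IsValid T P ⟨slink^[h] X, c :: Q, (slink^[h] Y, Y) :: s⟩) (hp : IsPlus T Y)
    (hh : IsFastLinkHeight T X Y h) (hentry : PointsToEntry L reg X c Y)
    (h₁₆ : reg 16 = .num (L.addr Y)) (h₁₇ : reg 17 = mem (L.addr Y)) :
    Ensures W matcherProgram 10 ⟨32, reg, mem⟩ fun y => y.pc = 6 ∧
      Represents T P L free p y.reg y.mem ⟨slink^[h] X, c :: Q, (slink^[h] Y, Y) :: s⟩ := by
  have hY : IsNode T Y := (hv.stack _ (List.mem_cons_self ..)).2.1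
  rw [hx.stores.plus_true Y hY hp] at h₁₇
  obtain ⟨j, hj, h₁₄⟩ := hentry
  have hjlt := (List.getElem?_eq_some_iff.1 hj).1
  have htable := hx.stores.table_le X hx.valid.node
  obtain ⟨hupper, hlower⟩ := hx.stores.fast_link X hx.valid.node j c Y hj h hh
  have htop := hx.top_le
  dsimp only at htop
  refine .jumpEq_pos rfl (h₁₇.trans hx.one.symm) ?_
  refine .add (L.table X + 4 * j) 2 rfl h₁₄ hx.two (by omega) ?_
  refine .load _ _ rfl (by simp) hupper ?_
  refine .add (L.table X + 4 * j) 3 rfl (by simp [h₁₄]) (by simp [hx.three]) (by omega) ?_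
  refine .load _ _ rfl (by simp) hlower ?_
  refine .add (free + 2 * s.length) 2 rfl (by simp [hx.top]) (by simp [hx.two]) (by omega) ?_
  rw [show free + 2 * s.length + 2 = free + 2 * (s.length + 1) by ring]
  refine .store (free + 2 * (s.length + 1)) (.num (L.addr (slink^[h] Y))) rfl (by simp)
    (by simp) ?_
  refine .add (free + 2 * (s.length + 1)) 1 rfl (by simp) (by simp [hx.one]) (by omega) ?_
  refine .store (free + 2 * (s.length + 1) + 1) (.num (L.addr Y)) rfl (by simp) (by simp [h₁₆]) ?_
  have hmem : ∀ a < free, Function.update (Function.update mem (free + 2 * (s.length + 1))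
      (.num (L.addr (slink^[h] Y)))) (free + 2 * (s.length + 1) + 1) (.num (L.addr Y)) a =
        mem a := fun a ha => by
    rw [Function.update_of_ne (by omega), Function.update_of_ne (by omega)]
  refine .jump rfl (.of_post ⟨rfl, hx.stores.congr hmem, hx.storesString.congr hmem,
    hx.storesStack.push _ _, hv, ?_, ?_, ?_, ?_, ?_, ?_, ?_, ?_⟩)
  all_goals simp [hx.pattern, hx.length, hx.matched, hx.one, hx.two, hx.three]

lemma Represents.ensures_pop {Q X : List α} {s : List (List α × List α)}
    (hx : Represents T P L free p reg mem ⟨X, Q, (X, Y) :: s⟩) (hW : 4 * (free + 1) ≤ W)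
    (hv : MatchState.IsValid T P ⟨Y, Q, s⟩) :
    Ensures W matcherProgram 6 ⟨6, reg, mem⟩ fun y => y.pc = 6 ∧
      Represents T P L free p y.reg y.mem ⟨Y, Q, s⟩ := by
  obtain ⟨hupper, hlower, hs⟩ := hx.storesStack
  have htop := hx.top
  have hle := hx.top_le
  rw [List.length_cons] at htop hle
  refine .load _ _ rfl htop hupper (.jumpEq_pos rfl (by simp [hx.node]) ?_)
  refine .add _ 1 rfl (by simpa using htop) (by simp [hx.one]) (by omega) ?_
  refine .load _ _ rfl (by simp) hlower ?_
  refine .sub (free + 2 * (s.length + 1)) 2 rfl (by simpa using htop) (by simp [hx.two])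
    (.jump rfl ?_)
  rw [show free + 2 * (s.length + 1) - 2 = free + 2 * s.length by omega]
  refine .of_post ⟨rfl, hx.stores, hx.storesString, hs, hv, ?_, ?_, ?_, ?_, ?_, ?_, ?_, ?_⟩
  all_goals simp [hx.pattern, hx.length, hx.matched, hx.one, hx.two, hx.three]

lemma Represents.ensures_step (hx : Represents T P L free p reg mem st)
    (hW : 4 * (free + 1) ≤ W) (hd : ∀ U, IsNode T U → (L.kids U).length ≤ d)
    (h : MatchStep T st st') :
    Ensures W matcherProgram (35 * (Nat.log 2 d + 1)) ⟨6, reg, mem⟩ fun y => y.pc = 6 ∧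
      Represents T P L free p y.reg y.mem st' := by
  have hv := h.isValid hx.valid
  have hdeg := hd _ hx.valid.node
  cases h with
  | advance hs hY hp =>
    refine (hx.ensures_child hW hdeg hs rfl hY).trans (m := 4) ?_ (by omega)
    rintro ⟨_, reg, mem⟩ ⟨rfl, hx, -, h₁₆, h₁₇⟩
    exact hx.ensures_advance hW hv hp h₁₆ h₁₇
  | push hs hY hp hh =>
    refine (hx.ensures_child hW hdeg hs rfl hY).trans (m := 10) ?_ (by omega)
    rintro ⟨_, reg, mem⟩ ⟨rfl, hx, hentry, h₁₆, h₁₇⟩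
    exact hx.ensures_push hW hv hp hh hentry h₁₆ h₁₇
  | pop => exact (hx.ensures_pop hW hv).mono (by omega)

lemma Represents.ensures_steps (hx : Represents T P L free p reg mem st)
    (hW : 4 * (free + 1) ≤ W) (hd : ∀ U, IsNode T U → (L.kids U).length ≤ d)
    (h : MatchSteps T n st st') :
    Ensures W matcherProgram (n * (35 * (Nat.log 2 d + 1))) ⟨6, reg, mem⟩ fun y => y.pc = 6 ∧
      Represents T P L free p y.reg y.mem st' := by
  induction h generalizing reg mem with
  | refl => exact .of_post ⟨rfl, hx⟩
  | head h _ ih =>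
    rw [Nat.add_comm, Nat.add_mul, Nat.one_mul]
    refine (hx.ensures_step hW hd h).trans ?_ le_rfl
    rintro ⟨_, reg, mem⟩ ⟨rfl, hx⟩
    exact ih hx

lemma Represents.ensures_output (hx : Represents T P L free p reg mem st) :
    Ensures W matcherProgram 1 ⟨49, reg, mem⟩ fun y =>
      matcherProgram[y.pc]? = some .halt ∧ y.reg 0 = .num (P.length - st.rest.length) := by
  refine .move _ rfl hx.matched (.of_post ⟨rfl, ?_⟩)
  simp

lemma Represents.ensures_halt (hx : Represents T P L free p reg mem st)
    (hW : 4 * (free + 1) ≤ W) (hd : ∀ U, IsNode T U → (L.kids U).length ≤ d)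
    (hst : st.IsFinal T) :
    Ensures W matcherProgram (35 * (Nat.log 2 d + 1)) ⟨6, reg, mem⟩ fun y =>
      matcherProgram[y.pc]? = some .halt ∧ y.reg 0 = .num (P.length - st.rest.length) := by
  refine (hx.ensures_notAtTarget hst.1).trans (m := 11 * (Nat.log 2 d + 1) + 10) ?_ (by omega)
  rintro ⟨_, reg, mem⟩ ⟨rfl, hx⟩
  obtain ⟨X, _ | ⟨c, Q⟩, s⟩ := st
  · exact .jumpEq_pos rfl (hx.matched.trans hx.length.symm) (hx.ensures_output.mono (by omega))
  · refine (hx.ensures_lookup hW (hd _ hx.valid.node) rfl).trans (m := 1) ?_ le_rfl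
    rintro ⟨_, reg, mem⟩ ⟨hx, ⟨rfl, -⟩ | ⟨-, Y, hY, -⟩⟩
    · exact hx.ensures_output
    · exact absurd hY.append_isInfix (hst.2 c rfl)

lemma IsMatchingInput.ensures_represents {x : Config α} (hx : IsMatchingInput T P L free p x)
    (hW : 4 * (free + 1) ≤ W) :
    Ensures W matcherProgram 6 x fun y => y.pc = 6 ∧
      Represents T P L free p y.reg y.mem ⟨[], P, []⟩ := by
  obtain ⟨_, reg, mem⟩ := x
  obtain ⟨hS, hP, rfl, h₀, h₁, h₂, h₃⟩ := hx
  dsimp only at hS hP h₀ h₁ h₂ h₃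
  refine .const rfl (Nat.zero_le _) (.const rfl (by omega) (.const rfl (by omega)
    (.const rfl (by omega) (.move (.num free) rfl (by simp [h₃]) ?_))))
  refine .store free (.num free) rfl (by simp) (by simp [h₃]) ?_
  have hmem : ∀ a < free, Function.update mem free (.num free) a = mem a :=
    fun a ha => Function.update_of_ne ha.ne _ _
  refine .of_post ⟨rfl, hS.congr hmem, hP.congr hmem, by simp [StoresStack], isValid_init T P,
    ?_, ?_, ?_, ?_, ?_, ?_, ?_, ?_⟩
  all_goals simp [h₀, h₁, h₂]

end Program

end LST

theorem mainTheorem4_general :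
    ∃ (prog : RAM.Program) (C : ℕ),
      ∀ (α : Type*) [LinearOrder α] (T P : List α)
        (L : LST.Layout α) (free p W d : ℕ) (x : RAM.Config α),
        LST.IsMatchingInput T P L free p x →
        (∀ U, LST.IsNode T U → (L.kids U).length ≤ d) →
        C * (free + 1) ≤ W →
        ∃ P' : List α, LST.IsLongestPrefix T P P' ∧
          RAM.HaltsWithin W prog x
            (C * ((P'.length + 1) * (Nat.log 2 d + 1))) P'.length := by
  refine ⟨LST.matcherProgram, 140, fun α _ T P L free p W d x hx hd hW => ?_⟩
  replace hW : 4 * (free + 1) ≤ W := by omega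
  obtain ⟨P', R, rfl, hlong, n, hn, Y, s, hsteps, hfinal⟩ :=
    LST.exists_matchSteps_isFinal (LST.isNode_nil T) P
  refine ⟨P', hlong, ?_⟩
  have hrun : RAM.Ensures W LST.matcherProgram (6 + (n + 1) * (35 * (Nat.log 2 d + 1))) x
      fun y => LST.matcherProgram[y.pc]? = some .halt ∧ y.reg 0 = .num P'.length := by
    refine (hx.ensures_represents hW).trans ?_ le_rfl
    rintro ⟨_, reg, mem⟩ ⟨rfl, hy⟩
    refine (hy.ensures_steps hW hd hsteps).trans ?_ (Nat.succ_mul _ _).ge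
    rintro ⟨_, reg, mem⟩ ⟨rfl, hz⟩
    simpa using hz.ensures_halt hW hd hfinal
  refine hrun.mono ?_
  rw [List.length_nil, Nat.mul_zero, Nat.add_zero] at hn
  have := Nat.mul_le_mul_right (35 * (Nat.log 2 d + 1)) (Nat.succ_le_succ hn)
  have := Nat.zero_le (P'.length * Nat.log 2 d)
  linarith

theorem mainTheorem4 :
    ∃ (prog : RAM.Program) (C : ℕ),
      ∀ (α : Type*) [Fintype α] [LinearOrder α] (T P : List α)
        (L : LST.Layout α) (free p W : ℕ) (x : RAM.Config α),
        LST.IsMatchingInput T P L free p x →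
        C * (free + 1) ≤ W →
        ∃ P' : List α, LST.IsLongestPrefix T P P' ∧
          RAM.HaltsWithin W prog x
            (C * ((P'.length + 1) * (Nat.log 2 (Fintype.card α) + 1))) P'.length := by
  obtain ⟨prog, C, h⟩ := mainTheorem4_general
  exact ⟨prog, C, fun α _ _ T P L free p W x hx =>
    h α T P L free p W _ x hx fun _ => hx.1.kids_length_le⟩
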